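/- A \emph{curve} is the image of an injective continuous map $[0,1]\to\mathbb{R}^2$. A family of curves is \emph{simple} if any two of its members share at most one point, and it is \emph{$K_k$-free} if no $k$ of its members pairwise intersect. Write $\chi(C)$ for the chromatic number of the intersection graph of a family $C$, i.e. the minimum number of colors needed to color the members of $C$ so that no two intersecting members receive the same color. Let $\beta$ be a (nondegenerate, closed) segment of a horizontal line in the plane. A curve $\gamma$ \emph{crosses $\beta$ at exactly one point} if $\gamma\cap\beta$ is a single point, this point is an endpoint neither of $\gamma$ nor of $\beta$, and $\gamma$ passes there from one side of $\beta$ to the other. The crossing point then divides $\gamma$ into two subcurves, both containing that point: the upper part $\gamma^+$, which enters $\beta$ from above, and the lower part $\gamma^-$, which enters $\beta$ from below. \textbf{Lemma.} Let $k\ge 2$ be an integer, and let $C$ be a simple $K_k$-free family of curves, each crossing $\beta$ at exactly one point. If $\gamma_1^+\cap\gamma_2^+=\emptyset$ and $\gamma_1^-\cap\gamma_2^-=\emptyset$ for any two distinct $\gamma_1,\gamma_2\in C$, then $$\chi(C)\le 2^{3k-6}.$$ -/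

import Mathlib

open Set Filter Topology

/-- A (simple, i.e. not self-intersecting) curve in the plane: the plane is `ℝ × ℝ`, and a curve is
an injective continuous map from the unit interval to it. -/
structure PlaneCurve where
  toFun : unitInterval → ℝ × ℝ
  continuous_toFun : Continuous toFun
  injective_toFun : Function.Injective toFun

/-- A nondegenerate horizontal segment, joining `(left, height)` to `(right, height)`. -/
structure HorizontalSegment where
  height : ℝ
  left : ℝ
  right : ℝ
  left_lt_right : left < right

namespace HorizontalSegment

/-- The points of the segment, endpoints included. -/
def carrier (β : HorizontalSegment) : Set (ℝ × ℝ) :=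
  {p | β.left ≤ p.1 ∧ p.1 ≤ β.right ∧ p.2 = β.height}

end HorizontalSegment

namespace PlaneCurve

/-- The set of points of a curve. -/
def carrier (γ : PlaneCurve) : Set (ℝ × ℝ) := range γ.toFun

/-- Just before the parameter `t`, the curve is strictly above the line containing `β`. -/
def AboveBefore (γ : PlaneCurve) (β : HorizontalSegment) (t : unitInterval) : Prop :=
  ∀ᶠ s in 𝓝[<] t, β.height < (γ.toFun s).2

/-- Just before the parameter `t`, the curve is strictly below the line containing `β`. -/
def BelowBefore (γ : PlaneCurve) (β : HorizontalSegment) (t : unitInterval) : Prop :=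
  ∀ᶠ s in 𝓝[<] t, (γ.toFun s).2 < β.height

/-- Just after the parameter `t`, the curve is strictly above the line containing `β`. -/
def AboveAfter (γ : PlaneCurve) (β : HorizontalSegment) (t : unitInterval) : Prop :=
  ∀ᶠ s in 𝓝[>] t, β.height < (γ.toFun s).2

/-- Just after the parameter `t`, the curve is strictly below the line containing `β`. -/
def BelowAfter (γ : PlaneCurve) (β : HorizontalSegment) (t : unitInterval) : Prop :=
  ∀ᶠ s in 𝓝[>] t, (γ.toFun s).2 < β.height

/-- The curve `γ` meets the segment `β` only at the parameter `t`; the common point is an endpoint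
neither of `γ` nor of `β`, and there `γ` passes from one side of `β` to the other. -/
structure CrossesOnlyAt (γ : PlaneCurve) (β : HorizontalSegment) (t : unitInterval) : Prop where
  pos : 0 < t
  lt_one : t < 1
  mem : γ.toFun t ∈ β.carrier
  left_lt : β.left < (γ.toFun t).1
  lt_right : (γ.toFun t).1 < β.right
  unique : ∀ s, γ.toFun s ∈ β.carrier → s = t
  changes_side : (γ.AboveBefore β t ∧ γ.BelowAfter β t) ∨ (γ.BelowBefore β t ∧ γ.AboveAfter β t)

/-- The curve `γ` crosses the segment `β` at exactly one point. -/
def CrossesOnce (γ : PlaneCurve) (β : HorizontalSegment) : Prop :=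
  ∃ t, γ.CrossesOnlyAt β t

/-- The upper part of a curve that crosses `β` at exactly one point: of the two subcurves into
which the crossing point divides the curve (both containing that point), the one that enters `β`
from above. -/
def upperPart (γ : PlaneCurve) (β : HorizontalSegment) : Set (ℝ × ℝ) :=
  {p | ∃ t, γ.CrossesOnlyAt β t ∧
    ((γ.AboveBefore β t ∧ p ∈ γ.toFun '' Iic t) ∨ (γ.AboveAfter β t ∧ p ∈ γ.toFun '' Ici t))}

/-- The lower part of a curve that crosses `β` at exactly one point: of the two subcurves into
which the crossing point divides the curve (both containing that point), the one that enters `β`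
from below. -/
def lowerPart (γ : PlaneCurve) (β : HorizontalSegment) : Set (ℝ × ℝ) :=
  {p | ∃ t, γ.CrossesOnlyAt β t ∧
    ((γ.BelowBefore β t ∧ p ∈ γ.toFun '' Iic t) ∨ (γ.BelowAfter β t ∧ p ∈ γ.toFun '' Ici t))}

/-- A family of curves is simple if any two of them share at most one point. -/
def IsSimpleFamily {ι : Type*} (C : ι → PlaneCurve) : Prop :=
  ∀ i j, i ≠ j → ((C i).carrier ∩ (C j).carrier).Subsingleton

/-- The intersection graph of a family of curves: two distinct members are adjacent when they share
a point. -/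
def intersectionGraph {ι : Type*} (C : ι → PlaneCurve) : SimpleGraph ι where
  Adj i j := i ≠ j ∧ ((C i).carrier ∩ (C j).carrier).Nonempty
  symm := ⟨fun _ _ h => ⟨h.1.symm, by rw [inter_comm]; exact h.2⟩⟩
  loopless := ⟨fun _ h => h.1 rfl⟩

end PlaneCurve

/-! Order the curves by their crossing points on β. Since upper parts are pairwise disjoint, as are
lower parts, two curves can meet only upper part against lower part, and off β. If `k`, `l` meet and
cross β between two meeting curves `i`, `j`, then following `k` upwards and returning along `l` from
below gives a path that must meet `i ∪ j` (`PlaneCurve.inter_nonempty_of_interlaced`); a winding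
argument with logarithms proves it (`Complex.exists_eq_of_interlaced`).

The rest is combinatorics of ordered graphs (`colorable_of_nested_adj`), by induction on the clique
number. Between the ends of an edge `uv`, the neighbors of `u` and those of `v` have smaller clique
number, and the remaining vertices are independent. So the span of every edge needs few colors, and
a greedy cut into intervals then colors the whole graph. -/

/-! ### Coloring ordered graphs -/

namespace SimpleGraph

variable {V : Type*}

/-- A set of vertices is properly colored by `n` colors if the coloring is extended arbitrarily
outside the set. -/
def ColorableOn (G : SimpleGraph V) (n : ℕ) (s : Set V) : Prop :=
  ∃ c : V → Fin n, ∀ u ∈ s, ∀ v ∈ s, G.Adj u v → c u ≠ c v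

theorem ColorableOn.mono {G : SimpleGraph V} {n : ℕ} {s t : Set V} (h : G.ColorableOn n t)
    (hst : s ⊆ t) : G.ColorableOn n s :=
  let ⟨c, hc⟩ := h
  ⟨c, fun u hu v hv => hc u (hst hu) v (hst hv)⟩

theorem ColorableOn.insert {G : SimpleGraph V} {n : ℕ} {s : Set V} (h : G.ColorableOn n s)
    (w : V) : G.ColorableOn (n + 1) (insert w s) := by
  classical
  obtain ⟨c, hc⟩ := h
  refine ⟨fun v => if v = w then Fin.last n else (c v).castSucc, ?_⟩
  intro u hu v hv huv
  have hne := huv.ne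
  by_cases h1 : u = w <;> by_cases h2 : v = w
  · exact absurd (h1.trans h2.symm) hne
  · simp [h1, h2, (Fin.castSucc_lt_last (c v)).ne']
  · simp [h1, h2, (Fin.castSucc_lt_last (c u)).ne]
  · simpa [h1, h2] using hc u (hu.resolve_left h1) v (hv.resolve_left h2) huv

theorem ColorableOn.of_induce {G : SimpleGraph V} {n : ℕ} (hn : 0 < n) {s : Set V}
    (h : (G.induce s).Colorable n) : G.ColorableOn n s := by
  classical
  obtain ⟨c⟩ := h
  refine ⟨fun v => if hv : v ∈ s then c ⟨v, hv⟩ else ⟨0, hn⟩, ?_⟩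
  intro u hu v hv huv
  simp only [hu, hv, dif_pos]
  exact c.valid (v := ⟨u, hu⟩) (w := ⟨v, hv⟩) huv

/-- Cut a finite upper set of vertices greedily into intervals, colored alternately with two
palettes; an edge that skips an interval would span a set with too large chromatic number. -/
theorem exists_palette_coloring [LinearOrder V] [Finite V] (G : SimpleGraph V) (m : ℕ)
    (h : ∀ u v, u < v → G.Adj u v → G.ColorableOn m (Ioo u v)) (n : ℕ) :
    ∀ (S : Set V) (p : Bool), IsUpperSet S → S.ncard ≤ n → ∃ c : V → Bool × Fin (m + 1),
      (∀ u ∈ S, ∀ v ∈ S, G.Adj u v → c u ≠ c v) ∧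
      ∀ u ∉ S, ∀ v ∈ S, G.Adj u v → (c v).1 = p := by
  classical
  induction n with
  | zero =>
    intro S p _ hS
    have hS' : S = ∅ := (ncard_eq_zero (toFinite S)).1 (Nat.le_zero.1 hS)
    subst hS'
    exact ⟨fun _ => (p, 0), by simp, by simp⟩
  | succ n ih =>
    intro S p hup hS
    rcases S.eq_empty_or_nonempty with rfl | hne
    · exact ⟨fun _ => (p, 0), by simp, by simp⟩
    obtain ⟨a, haS, hamin⟩ := exists_min_image S id (toFinite S) hne
    have haB : a ∈ {b ∈ S | G.ColorableOn (m + 1) (S ∩ Iic b)} := by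
      refine ⟨haS, fun _ => 0, ?_⟩
      rintro u ⟨hu, hua⟩ v ⟨hv, hva⟩ huv
      exact absurd (le_antisymm (le_trans hua (hamin v hv)) (le_trans hva (hamin u hu))) huv.ne
    -- The first interval `S ∩ Iic b` is the longest one that `m + 1` colors suffice for.
    obtain ⟨b, ⟨hbS, c₁, hc₁⟩, hbmax⟩ := exists_max_image _ id (toFinite _) ⟨a, haB⟩
    have hup' : IsUpperSet (S ∩ Ioi b) := hup.inter (isUpperSet_Ioi b)
    have hcard : (S ∩ Ioi b).ncard ≤ n := by
      have : (S ∩ Ioi b).ncard < S.ncard := by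
        apply ncard_lt_ncard _ (toFinite S)
        exact ⟨inter_subset_left, fun hh => lt_irrefl b (hh hbS).2⟩
      omega
    obtain ⟨c₂, hc₂, hc₂'⟩ := ih (S ∩ Ioi b) (!p) hup' hcard
    -- An edge jumping over the first interval would make it `m`-colorable; one more color then
    -- admits the next vertex `w`, against the maximality of `b`.
    have key : ∀ u ∉ S, ∀ v ∈ S, b < v → ¬ G.Adj u v := by
      intro u hu v hv hbv huv
      have hlt : ∀ x ∈ S, u < x := fun x hx => by
        by_contra hle
        exact hu (hup (not_lt.1 hle) hx)
      obtain ⟨w, hw, hwmin⟩ := exists_min_image (S ∩ Ioi b) id (toFinite _) ⟨v, hv, hbv⟩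
      have h1 : G.ColorableOn m (S ∩ Iic b) := (h u v (hlt v hv) huv).mono
        fun x hx => ⟨hlt x hx.1, lt_of_le_of_lt hx.2 hbv⟩
      have h2 : G.ColorableOn (m + 1) (S ∩ Iic w) := (h1.insert w).mono fun x hx => by
        rcases le_or_gt x b with hxb | hxb
        · exact Or.inr ⟨hx.1, hxb⟩
        · exact Or.inl (le_antisymm hx.2 (hwmin x ⟨hx.1, hxb⟩))
      exact absurd (hbmax w ⟨hw.1, h2⟩) (not_le.2 hw.2)
    refine ⟨fun v => if v ≤ b then (p, c₁ v) else c₂ v, ?_, ?_⟩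
    -- The induction hypothesis for the palette `!p` puts every later vertex with a neighbor in the
    -- first interval into the other palette.
    · have hmix : ∀ u ∈ S, ∀ v ∈ S, u ≤ b → b < v → G.Adj u v → (p, c₁ u) ≠ c₂ v := by
        intro u hu v hv hub hvb huv heq
        have := hc₂' u (fun hh => not_lt.2 hub hh.2) v ⟨hv, hvb⟩ huv
        rw [← heq] at this
        simp at this
      intro u hu v hv huv
      rcases le_or_gt u b with hub | hub <;> rcases le_or_gt v b with hvb | hvb
      · simp only [hub, hvb, if_true]
        exact fun heq => hc₁ u ⟨hu, hub⟩ v ⟨hv, hvb⟩ huv (Prod.ext_iff.1 heq).2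
      · simp only [hub, not_le.2 hvb, if_true, if_false]
        exact hmix u hu v hv hub hvb huv
      · simp only [hvb, not_le.2 hub, if_true, if_false]
        exact (hmix v hv u hu hvb hub huv.symm).symm
      · simp only [not_le.2 hub, not_le.2 hvb, if_false]
        exact hc₂ u ⟨hu, hub⟩ v ⟨hv, hvb⟩ huv
    · intro u hu v hv huv
      rcases le_or_gt v b with hvb | hvb
      · simp [hvb]
      · exact absurd huv (key u hu v hv hvb)

theorem colorable_of_span_colorableOn [LinearOrder V] [Finite V] (G : SimpleGraph V) (m : ℕ)
    (h : ∀ u v, u < v → G.Adj u v → G.ColorableOn m (Ioo u v)) : G.Colorable (2 * (m + 1)) := by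
  obtain ⟨c, hc, -⟩ := G.exists_palette_coloring m h _ univ true isUpperSet_univ le_rfl
  have := (Coloring.mk c fun {u v} huv => hc u (mem_univ u) v (mem_univ v) huv).colorable
  simpa using this

theorem CliqueFree.induce_neighborSet {G : SimpleGraph V} {n : ℕ} (h : G.CliqueFree (n + 1))
    (v : V) : (G.induce (G.neighborSet v)).CliqueFree n := by
  classical
  intro s hs
  have h1 : G.IsNClique n (s.map (Function.Embedding.subtype _)) :=
    hs.map.mono (by rw [SimpleGraph.map_le_iff_le_comap])
  refine h _ (h1.insert (a := v) ?_)
  intro b hb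
  obtain ⟨x, -, rfl⟩ := Finset.mem_map.1 hb
  exact x.2

/-- If any two edges, the second one with both ends strictly between the ends of the first, are
joined by an edge, then the chromatic number is exponentially bounded by the clique number. -/
theorem colorable_of_nested_adj (n : ℕ) : ∀ {V : Type*} [LinearOrder V] [Finite V]
    (G : SimpleGraph V),
    (∀ i j k l, G.Adj i j → G.Adj k l → k ∈ Ioo i j → l ∈ Ioo i j →
      G.Adj i k ∨ G.Adj i l ∨ G.Adj j k ∨ G.Adj j l) →
    G.CliqueFree (n + 2) → G.Colorable (8 ^ n) := by
  classical
  induction n with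
  | zero =>
    intro V _ _ G _ hfree
    rw [zero_add, cliqueFree_two] at hfree
    subst hfree
    exact ⟨Coloring.mk (fun _ => 0) (by simp)⟩
  | succ n ih =>
    intro V _ _ G hG hfree
    have hN : ∀ v, G.ColorableOn (8 ^ n) (G.neighborSet v) := fun v =>
      ColorableOn.of_induce (by positivity) <| ih _
        (fun i j k l hij hkl hk hl => hG i j k l hij hkl hk hl) (hfree.induce_neighborSet v)
    -- One palette for the neighbors of `u`, one for the remaining neighbors of `v`, and a single
    -- color for the rest, which `hG` makes independent.
    have hspan : ∀ u v, u < v → G.Adj u v → G.ColorableOn (8 ^ n + 8 ^ n + 1) (Ioo u v) := by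
      intro u v _ huv
      obtain ⟨c₁, hc₁⟩ := hN u
      obtain ⟨c₂, hc₂⟩ := hN v
      let e : (Fin (8 ^ n) ⊕ Fin (8 ^ n)) ⊕ Fin 1 ≃ Fin (8 ^ n + 8 ^ n + 1) :=
        (Equiv.sumCongr finSumFinEquiv (Equiv.refl _)).trans finSumFinEquiv
      refine ⟨fun x => e (if G.Adj u x then .inl (.inl (c₁ x)) else
        if G.Adj v x then .inl (.inr (c₂ x)) else .inr 0), ?_⟩
      intro x hx y hy hxy
      rw [e.injective.ne_iff]
      have h0 := hG u v x y huv hxy hx hy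
      intro heq
      split_ifs at heq
      all_goals first
        | exact hc₁ x ‹G.Adj u x› y ‹G.Adj u y› hxy (Sum.inl.inj (Sum.inl.inj heq))
        | exact hc₂ x ‹G.Adj v x› y ‹G.Adj v y› hxy (Sum.inr.inj (Sum.inl.inj heq))
        | tauto
        | simp at heq
    refine (G.colorable_of_span_colorableOn _ hspan).mono ?_
    -- The count is `2 * (2 * 8 ^ n + 2) = 4 * 8 ^ n + 4 ≤ 8 * 8 ^ n`.
    have : 1 ≤ 8 ^ n := Nat.one_le_pow _ _ (by norm_num)
    rw [pow_succ]
    omega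

end SimpleGraph

/-! ### Crossing paths via continuous logarithms -/

namespace Complex

/-- If the quotient were `-r` with `r ≥ 0`, then `z = (r * p + q) / (1 + r)` would be a convex
combination of `p` and `q`. -/
theorem div_mem_slitPlane_of_notMem_uIcc {p q : ℝ} {z : ℂ} (h : ∀ x ∈ uIcc p q, z ≠ (x : ℂ)) :
    (z - q) / (z - p) ∈ slitPlane := by
  have hp : z - p ≠ 0 := sub_ne_zero.2 (h p left_mem_uIcc)
  by_contra hcon
  rw [mem_slitPlane_iff, not_or, not_lt, not_not] at hcon
  obtain ⟨r, hr⟩ : ∃ r : ℝ, (z - q) / (z - p) = -r :=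
    ⟨-((z - q) / (z - p)).re, by apply Complex.ext <;> simp [hcon.2]⟩
  have hr0 : 0 ≤ r := by
    have := hcon.1
    rw [hr] at this
    simpa using this
  rw [div_eq_iff hp] at hr
  have h1 : (1 + r : ℝ) ≠ 0 := by positivity
  have h1' : (1 + r : ℂ) ≠ 0 := by exact_mod_cast h1
  refine h ((r / (1 + r)) * p + (1 / (1 + r)) * q) ?_ ?_
  · exact convex_uIcc p q left_mem_uIcc right_mem_uIcc (a := r / (1 + r)) (b := 1 / (1 + r))
      (by positivity) (by positivity) (by field_simp; ring)
  · push_cast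
    field_simp
    linear_combination hr

theorem im_div_sub_ofReal (p q : ℝ) (z : ℂ) :
    ((z - q) / (z - p)).im = z.im * (q - p) / normSq (z - p) := by
  rw [div_im]
  simp
  ring

/-- A continuous logarithm of a function with values in the slit plane differs from the principal
branch by a constant. -/
theorem exists_im_eq_arg_exp_add {S : Set ℝ} (hS : IsPreconnected S) {Φ : ℝ → ℂ}
    (hΦ : ContinuousOn Φ S) (h : ∀ t ∈ S, exp (Φ t) ∈ slitPlane) :
    ∃ y : ℝ, ∀ t ∈ S, (Φ t).im = arg (exp (Φ t)) + y := by
  have hT : DiscreteTopology (range ((↑) : ℤ → ℝ)) :=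
    Int.isClosedEmbedding_coe_real.isEmbedding.toHomeomorph.symm.isEmbedding.discreteTopology
  -- This continuous function takes integer values, hence is constant on a preconnected set.
  have hc : ContinuousOn (fun t => ((Φ t).im - arg (exp (Φ t))) / (2 * Real.pi)) S :=
    ((continuous_im.comp_continuousOn hΦ).sub
      (continuousOn_arg.comp (continuous_exp.comp_continuousOn hΦ) h)).div_const _
  have hmaps : MapsTo (fun t => ((Φ t).im - arg (exp (Φ t))) / (2 * Real.pi)) S
      (range ((↑) : ℤ → ℝ)) := by
    intro t _
    obtain ⟨n, hn⟩ := exp_eq_exp_iff_exists_int.1 (exp_log (exp_ne_zero (Φ t))).symm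
    refine ⟨n, ?_⟩
    have := congrArg im hn
    rw [add_im, log_im] at this
    change (n : ℝ) = ((Φ t).im - arg (exp (Φ t))) / (2 * Real.pi)
    rw [this]
    simp
  obtain ⟨y, -, hy⟩ := hS.eqOn_const_of_mapsTo ⟨hT⟩ hc hmaps (range_nonempty _)
  refine ⟨y * (2 * Real.pi), fun t ht => ?_⟩
  rw [← show _ / _ = y from hy ht]
  field_simp
  ring

theorem exists_continuous_exp_eq {X : Type*} [TopologicalSpace X] [SimplyConnectedSpace X]
    [LocallyPathConnectedSpace X] {g : X → ℂ} (hg : Continuous g) (h0 : ∀ x, g x ≠ 0) :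
    ∃ f : X → ℂ, Continuous f ∧ ∀ x, exp (f x) = g x := by
  obtain ⟨x₀⟩ : Nonempty X := inferInstance
  obtain ⟨f, ⟨-, hf⟩, -⟩ := isCoveringMapOn_exp.existsUnique_continuousMap_lifts ⟨g, hg⟩
    (a₀ := x₀) (exp_log (h0 x₀)) h0
  exact ⟨f, f.continuous, fun x => congrFun hf x⟩

/-- Let the ends of `δ` lie on the real axis strictly between the ends `a` and `b` of `γ`. If `δ`
leaves the segment `[a, b]` upwards and returns to it from below, while `γ` does not meet the
segment between the ends of `δ`, then the two paths meet. -/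
theorem exists_eq_of_interlaced {γ δ : ℝ → ℂ} (hγ : Continuous γ) (hδ : Continuous δ)
    {a b c d : ℝ} (hγ0 : γ 0 = a) (hγ1 : γ 1 = b) (hδ0 : δ 0 = c) (hδ1 : δ 1 = d)
    (hc : c ∈ Ioo a b) (hd : d ∈ Ioo a b)
    (hγ' : ∀ s, ∀ x ∈ uIcc c d, γ s ≠ (x : ℝ))
    (hδ' : ∀ t ∈ Ioo (0 : ℝ) 1, ∀ x ∈ Icc a b, δ t ≠ (x : ℝ))
    (hpos : ∀ᶠ t in 𝓝[>] 0, 0 < (δ t).im) (hneg : ∀ᶠ t in 𝓝[<] 1, (δ t).im < 0) :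
    ∃ s t, γ s = δ t := by
  by_contra! hne
  have hab : a < b := hc.1.trans hc.2
  -- If the paths never meet, `γ s - δ t` has a continuous logarithm on the whole parameter plane.
  -- Its increments across opposite sides of the unit square are compared below.
  obtain ⟨L, hL, hLexp⟩ := exists_continuous_exp_eq (X := ℝ × ℝ)
    (g := fun x => γ x.1 - δ x.2) (by fun_prop) (fun x => sub_ne_zero.2 (hne x.1 x.2))
  let Φ : ℝ → ℂ := fun t => L (1, t) - L (0, t)
  let Ψ : ℝ → ℂ := fun s => L (s, 1) - L (s, 0)
  have hΦc : Continuous Φ := by fun_prop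
  have hΨc : Continuous Ψ := by fun_prop
  have hΦe : ∀ t, exp (Φ t) = (δ t - b) / (δ t - a) := fun t => by
    rw [exp_sub, hLexp, hLexp, ← neg_div_neg_eq]
    simp [hγ0, hγ1]
  have hΨe : ∀ s, exp (Ψ s) = (γ s - d) / (γ s - c) := fun s => by
    rw [exp_sub, hLexp, hLexp]
    simp [hδ0, hδ1]
  obtain ⟨m, hm⟩ := exists_im_eq_arg_exp_add isPreconnected_univ hΨc.continuousOn
    fun s _ => by rw [hΨe]; exact div_mem_slitPlane_of_notMem_uIcc (hγ' s)
  obtain ⟨n, hn⟩ := exists_im_eq_arg_exp_add isPreconnected_Ioo hΦc.continuousOn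
    (S := Ioo 0 1) fun t ht => by
      rw [hΦe]
      exact div_mem_slitPlane_of_notMem_uIcc (by rw [uIcc_of_le hab.le]; exact hδ' t ht)
  have hreal : ∀ x y z : ℝ, ((z : ℂ) - y) / (z - x) = (((z - y) / (z - x) : ℝ) : ℂ) := by
    intros; push_cast; rfl
  have hΨ0 : (Ψ 0).im = m := by
    rw [hm 0 (mem_univ _), hΨe, hγ0, hreal, arg_ofReal_of_nonneg, zero_add]
    exact div_nonneg_of_nonpos (by linarith [hd.1]) (by linarith [hc.1])
  have hΨ1 : (Ψ 1).im = m := by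
    rw [hm 1 (mem_univ _), hΨe, hγ1, hreal, arg_ofReal_of_nonneg, zero_add]
    exact div_nonneg (by linarith [hd.2]) (by linarith [hc.2])
  have hnegre : ∀ t, ∀ x ∈ Ioo a b, δ t = (x : ℝ) →
      (exp (Φ t)).re < 0 ∧ (exp (Φ t)).im = 0 := by
    intro t x hx ht
    rw [hΦe, ht, hreal, ofReal_re, ofReal_im]
    exact ⟨div_neg_of_neg_of_pos (by linarith [hx.2]) (by linarith [hx.1]), rfl⟩
  have him : ∀ t, (exp (Φ t)).im = (δ t).im * (b - a) / normSq (δ t - a) := fun t => by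
    rw [hΦe, im_div_sub_ofReal]
  have hnorm : ∀ t, 0 < normSq (δ t - a) := fun t =>
    normSq_pos.2 (sub_ne_zero.2 (hγ0 ▸ (hne 0 t).symm))
  have hexp : Continuous fun t => exp (Φ t) := by fun_prop
  -- At the ends of `δ` the quotient is a negative real, on the branch cut. The one-sided limit of
  -- `arg` is `π` at the start, from above, and `-π` at the end, from below.
  have hΦ0 : (Φ 0).im = Real.pi + n := by
    have h1 : Tendsto (fun t => (Φ t).im) (𝓝[>] 0) (𝓝 (Φ 0).im) :=
      (continuous_im.comp hΦc).continuousAt.tendsto.mono_left nhdsWithin_le_nhds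
    obtain ⟨hre, hi⟩ := hnegre 0 c hc hδ0
    have h2 : Tendsto (fun t => arg (exp (Φ t)) + n) (𝓝[>] 0) (𝓝 (Real.pi + n)) := by
      refine Tendsto.add_const n
        ((tendsto_arg_nhdsWithin_im_nonneg_of_re_neg_of_im_zero hre hi).comp ?_)
      refine tendsto_nhdsWithin_iff.2 ⟨hexp.continuousAt.tendsto.mono_left nhdsWithin_le_nhds, ?_⟩
      filter_upwards [hpos] with t ht
      rw [him]
      exact div_nonneg (mul_nonneg ht.le (by linarith)) (hnorm t).le
    refine tendsto_nhds_unique h1 (h2.congr' ?_)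
    filter_upwards [Ioo_mem_nhdsGT (zero_lt_one' ℝ)] with t ht using (hn t ht).symm
  have hΦ1 : (Φ 1).im = -Real.pi + n := by
    have h1 : Tendsto (fun t => (Φ t).im) (𝓝[<] 1) (𝓝 (Φ 1).im) :=
      (continuous_im.comp hΦc).continuousAt.tendsto.mono_left nhdsWithin_le_nhds
    obtain ⟨hre, hi⟩ := hnegre 1 d hd hδ1
    have h2 : Tendsto (fun t => arg (exp (Φ t)) + n) (𝓝[<] 1) (𝓝 (-Real.pi + n)) := by
      refine Tendsto.add_const n
        ((tendsto_arg_nhdsWithin_im_neg_of_re_neg_of_im_zero hre hi).comp ?_)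
      refine tendsto_nhdsWithin_iff.2 ⟨hexp.continuousAt.tendsto.mono_left nhdsWithin_le_nhds, ?_⟩
      filter_upwards [hneg] with t ht
      rw [him]
      exact div_neg_of_neg_of_pos (mul_neg_of_neg_of_pos ht (by linarith)) (hnorm t)
    refine tendsto_nhds_unique h1 (h2.congr' ?_)
    filter_upwards [Ioo_mem_nhdsLT (zero_lt_one' ℝ)] with t ht using (hn t ht).symm
  -- Both sides are the same alternating sum of `L` over the corners of the square, yet the left is
  -- `-2π` and the right is `0`.
  have hcomm : (Φ 1).im - (Φ 0).im = (Ψ 1).im - (Ψ 0).im := by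
    simp only [Φ, Ψ, sub_im]
    ring
  linarith [Real.pi_pos]

end Complex

/-! ### Concatenation of paths -/

/-- Follow `f` from `0` to `1` and then `g` backwards from `1` to `0`. -/
noncomputable def glueAtOne {X : Type*} (f g : ℝ → X) (u : ℝ) : X :=
  if u ≤ 1 / 2 then f (2 * u) else g (2 - 2 * u)

section glueAtOne

variable {X : Type*} {f g : ℝ → X}

theorem continuous_glueAtOne [TopologicalSpace X] (hf : Continuous f) (hg : Continuous g)
    (h : f 1 = g 1) : Continuous (glueAtOne f g) := by
  refine Continuous.if_le (by fun_prop) (by fun_prop) continuous_id continuous_const ?_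
  rintro x rfl
  norm_num [h]

theorem glueAtOne_zero : glueAtOne f g 0 = f 0 := by simp [glueAtOne]

theorem glueAtOne_one : glueAtOne f g 1 = g 0 := by norm_num [glueAtOne]

theorem glueAtOne_mem {s t : Set X} (hf : ∀ u, f u ∈ s) (hg : ∀ u, g u ∈ t) (u : ℝ) :
    glueAtOne f g u ∈ s ∪ t := by
  unfold glueAtOne
  split_ifs
  exacts [Or.inl (hf _), Or.inr (hg _)]

theorem glueAtOne_mem_of_mem_Ioo {s : Set X} (hf : ∀ u ∈ Ioc (0 : ℝ) 1, f u ∈ s)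
    (hg : ∀ u ∈ Ioc (0 : ℝ) 1, g u ∈ s) {u : ℝ} (hu : u ∈ Ioo (0 : ℝ) 1) :
    glueAtOne f g u ∈ s := by
  unfold glueAtOne
  split_ifs with h
  · exact hf _ ⟨by linarith [hu.1], by linarith⟩
  · exact hg _ ⟨by linarith [hu.2], by linarith⟩

theorem eventually_glueAtOne_nhdsGT_zero {Q : X → Prop} (hf : ∀ᶠ u in 𝓝[>] 0, Q (f u)) :
    ∀ᶠ u in 𝓝[>] 0, Q (glueAtOne f g u) := by
  have h : Tendsto (fun u : ℝ => 2 * u) (𝓝[>] 0) (𝓝[>] 0) := by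
    refine tendsto_nhdsWithin_iff.2 ⟨?_, ?_⟩
    · exact ((continuous_const.mul continuous_id).tendsto' _ _ (by simp)).mono_left
        nhdsWithin_le_nhds
    · filter_upwards [self_mem_nhdsWithin] with u (hu : 0 < u)
      exact mul_pos two_pos hu
  filter_upwards [h.eventually hf, Ioo_mem_nhdsGT (one_half_pos (α := ℝ))] with u hu hu'
  rwa [glueAtOne, if_pos hu'.2.le]

theorem eventually_glueAtOne_nhdsLT_one {Q : X → Prop} (hg : ∀ᶠ u in 𝓝[>] 0, Q (g u)) :
    ∀ᶠ u in 𝓝[<] 1, Q (glueAtOne f g u) := by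
  have h : Tendsto (fun u : ℝ => 2 - 2 * u) (𝓝[<] 1) (𝓝[>] 0) := by
    refine tendsto_nhdsWithin_iff.2 ⟨?_, ?_⟩
    · exact ((continuous_const.sub (continuous_const.mul continuous_id)).tendsto' _ _
        (by simp)).mono_left nhdsWithin_le_nhds
    · filter_upwards [self_mem_nhdsWithin] with u (hu : u < 1)
      change 0 < 2 - 2 * u
      linarith
  filter_upwards [h.eventually hg, Ioo_mem_nhdsLT (one_half_lt_one (α := ℝ))] with u hu hu'
  rwa [glueAtOne, if_neg (not_le.2 hu'.1)]

end glueAtOne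

/-! ### Subcurves and interlaced pairs of curves -/

namespace PlaneCurve

variable {γ : PlaneCurve} {β : HorizontalSegment} {s t : unitInterval}

/-- The subcurve from the parameter `t` to the parameter `s`, traversed at constant speed during
the time interval `[0, 1]`. -/
noncomputable def subpath (γ : PlaneCurve) (t s : unitInterval) (u : ℝ) : ℝ × ℝ :=
  γ.toFun (projIcc 0 1 zero_le_one ((t : ℝ) + u * (s - t)))

theorem continuous_subpath (γ : PlaneCurve) (t s : unitInterval) : Continuous (γ.subpath t s) :=
  γ.continuous_toFun.comp (continuous_projIcc.comp (by fun_prop))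

theorem subpath_mem (γ : PlaneCurve) (t s : unitInterval) (u : ℝ) :
    γ.subpath t s u ∈ γ.carrier := mem_range_self _

theorem subpath_zero (γ : PlaneCurve) (t s : unitInterval) : γ.subpath t s 0 = γ.toFun t := by
  simp [subpath]

theorem subpath_one (γ : PlaneCurve) (t s : unitInterval) : γ.subpath t s 1 = γ.toFun s := by
  simp [subpath]

theorem coe_projIcc_of_mem_Ioc (t s : unitInterval) {u : ℝ} (hu : u ∈ Ioc (0 : ℝ) 1) :
    (projIcc (0 : ℝ) 1 zero_le_one ((t : ℝ) + u * (s - t)) : ℝ) = t + u * (s - t) := by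
  rw [projIcc_of_mem zero_le_one (x := (t : ℝ) + u * (s - t))]
  have h := (convex_Icc (0 : ℝ) 1) t.2 s.2 (by linarith [hu.2] : 0 ≤ 1 - u) hu.1.le (by ring)
  convert h using 1
  simp only [smul_eq_mul]
  ring

theorem CrossesOnlyAt.subpath_notMem (h : γ.CrossesOnlyAt β t) (hst : s ≠ t) {u : ℝ}
    (hu : u ∈ Ioc (0 : ℝ) 1) : γ.subpath t s u ∉ β.carrier := by
  intro hmem
  have h1 := congrArg (Subtype.val) (h.unique _ hmem)
  rw [coe_projIcc_of_mem_Ioc t s hu, add_eq_left, mul_eq_zero, sub_eq_zero] at h1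
  exact h1.elim hu.1.ne' fun h2 => hst (Subtype.ext h2)

theorem tendsto_projIcc_nhdsGT (t s : unitInterval) (I : Set unitInterval)
    (hI : ∀ u ∈ Ioc (0 : ℝ) 1, projIcc (0 : ℝ) 1 zero_le_one ((t : ℝ) + u * (s - t)) ∈ I) :
    Tendsto (fun u : ℝ => projIcc (0 : ℝ) 1 zero_le_one ((t : ℝ) + u * (s - t))) (𝓝[>] 0)
      (𝓝[I] t) := by
  refine tendsto_nhdsWithin_iff.2 ⟨?_, ?_⟩
  · exact ((continuous_projIcc.comp (by fun_prop)).tendsto' _ _ (by simp)).mono_left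
      nhdsWithin_le_nhds
  · filter_upwards [Ioc_mem_nhdsGT (zero_lt_one' ℝ)] with u hu using hI u hu

theorem eventually_subpath_of_lt {Q : ℝ × ℝ → Prop} (hst : s < t)
    (h : ∀ᶠ r in 𝓝[<] t, Q (γ.toFun r)) : ∀ᶠ u in 𝓝[>] 0, Q (γ.subpath t s u) := by
  refine (tendsto_projIcc_nhdsGT t s (Iio t) fun u hu => ?_).eventually h
  have hst' : (s : ℝ) < t := hst
  rw [mem_Iio, ← Subtype.coe_lt_coe, coe_projIcc_of_mem_Ioc t s hu]
  nlinarith [hu.1]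

theorem eventually_subpath_of_gt {Q : ℝ × ℝ → Prop} (hst : t < s)
    (h : ∀ᶠ r in 𝓝[>] t, Q (γ.toFun r)) : ∀ᶠ u in 𝓝[>] 0, Q (γ.subpath t s u) := by
  refine (tendsto_projIcc_nhdsGT t s (Ioi t) fun u hu => ?_).eventually h
  have hst' : (t : ℝ) < s := hst
  rw [mem_Ioi, ← Subtype.coe_lt_coe, coe_projIcc_of_mem_Ioc t s hu]
  nlinarith [hu.1]

theorem CrossesOnlyAt.exists_subpath_of_mem_upperPart (h : γ.CrossesOnlyAt β t) {p : ℝ × ℝ}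
    (hp : p ∈ γ.upperPart β) (hpβ : p ∉ β.carrier) : ∃ s, s ≠ t ∧ γ.toFun s = p ∧
      ∀ᶠ u in 𝓝[>] 0, β.height < (γ.subpath t s u).2 := by
  obtain ⟨t', ht', hside⟩ := hp
  obtain rfl := h.unique t' ht'.mem
  rcases hside with ⟨hs, s, hst, rfl⟩ | ⟨hs, s, hst, rfl⟩ <;>
    have hne : s ≠ t' := fun hh => hpβ (hh ▸ h.mem)
  · exact ⟨s, hne, rfl, eventually_subpath_of_lt (Q := fun q => β.height < q.2)
      (lt_of_le_of_ne hst hne) hs⟩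
  · exact ⟨s, hne, rfl, eventually_subpath_of_gt (Q := fun q => β.height < q.2)
      (lt_of_le_of_ne hst hne.symm) hs⟩

theorem CrossesOnlyAt.exists_subpath_of_mem_lowerPart (h : γ.CrossesOnlyAt β t) {p : ℝ × ℝ}
    (hp : p ∈ γ.lowerPart β) (hpβ : p ∉ β.carrier) : ∃ s, s ≠ t ∧ γ.toFun s = p ∧
      ∀ᶠ u in 𝓝[>] 0, (γ.subpath t s u).2 < β.height := by
  obtain ⟨t', ht', hside⟩ := hp
  obtain rfl := h.unique t' ht'.mem
  rcases hside with ⟨hs, s, hst, rfl⟩ | ⟨hs, s, hst, rfl⟩ <;>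
    have hne : s ≠ t' := fun hh => hpβ (hh ▸ h.mem)
  · exact ⟨s, hne, rfl, eventually_subpath_of_lt (Q := fun q => q.2 < β.height)
      (lt_of_le_of_ne hst hne) hs⟩
  · exact ⟨s, hne, rfl, eventually_subpath_of_gt (Q := fun q => q.2 < β.height)
      (lt_of_le_of_ne hst hne.symm) hs⟩

theorem CrossesOnlyAt.mem_upperPart (h : γ.CrossesOnlyAt β t) : γ.toFun t ∈ γ.upperPart β :=
  ⟨t, h, h.changes_side.imp (fun hs => ⟨hs.1, t, self_mem_Iic, rfl⟩) fun hs => ⟨hs.2, t, self_mem_Ici, rfl⟩⟩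

theorem CrossesOnlyAt.carrier_subset (h : γ.CrossesOnlyAt β t) :
    γ.carrier ⊆ γ.upperPart β ∪ γ.lowerPart β := by
  rintro _ ⟨s, rfl⟩
  rcases h.changes_side with hs | hs <;> rcases le_total s t with hst | hst
  · exact Or.inl ⟨t, h, Or.inl ⟨hs.1, s, hst, rfl⟩⟩
  · exact Or.inr ⟨t, h, Or.inr ⟨hs.2, s, hst, rfl⟩⟩
  · exact Or.inr ⟨t, h, Or.inl ⟨hs.1, s, hst, rfl⟩⟩
  · exact Or.inl ⟨t, h, Or.inr ⟨hs.2, s, hst, rfl⟩⟩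

theorem CrossesOnlyAt.eq_of_mem (h : γ.CrossesOnlyAt β t) {p : ℝ × ℝ} (hp : p ∈ γ.carrier)
    (hpβ : p ∈ β.carrier) : p = γ.toFun t := by
  obtain ⟨s, rfl⟩ := hp
  rw [h.unique s hpβ]

/-- Two intersecting curves that cross `β` cannot be separated from two curves that cross `β`
between them and of which the upper part of one intersects the lower part of the other. -/
theorem inter_nonempty_of_interlaced {γ₁ γ₂ δ₁ δ₂ : PlaneCurve} {t₁ t₂ s₁ s₂ : unitInterval}
    (hγ₁ : γ₁.CrossesOnlyAt β t₁) (hγ₂ : γ₂.CrossesOnlyAt β t₂)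
    (hδ₁ : δ₁.CrossesOnlyAt β s₁) (hδ₂ : δ₂.CrossesOnlyAt β s₂)
    (hγ : (γ₁.carrier ∩ γ₂.carrier).Nonempty) {p : ℝ × ℝ} (hp₁ : p ∈ δ₁.upperPart β)
    (hp₂ : p ∈ δ₂.lowerPart β) (hpβ : p ∉ β.carrier)
    (h₁ : (δ₁.toFun s₁).1 ∈ Ioo (γ₁.toFun t₁).1 (γ₂.toFun t₂).1)
    (h₂ : (δ₂.toFun s₂).1 ∈ Ioo (γ₁.toFun t₁).1 (γ₂.toFun t₂).1) :
    ((γ₁.carrier ∪ γ₂.carrier) ∩ (δ₁.carrier ∪ δ₂.carrier)).Nonempty := by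
  obtain ⟨_, ⟨r₁, rfl⟩, r₂, hr⟩ := hγ
  obtain ⟨q₁, hq₁, hqp₁, hup⟩ := hδ₁.exists_subpath_of_mem_upperPart hp₁ hpβ
  obtain ⟨q₂, hq₂, hqp₂, hlow⟩ := hδ₂.exists_subpath_of_mem_lowerPart hp₂ hpβ
  -- Identify the plane with `ℂ` so that the line containing β becomes the real axis.
  let φ : ℝ × ℝ → ℂ := fun x => ⟨x.1, x.2 - β.height⟩
  have hφ : Continuous φ := by
    have : φ = fun x => Complex.equivRealProdCLM.symm (x.1, x.2 - β.height) := rfl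
    rw [this]
    fun_prop
  have hφinj : ∀ x y, φ x = φ y → x = y := fun x y hxy => by
    have h := Complex.ext_iff.1 hxy
    exact Prod.ext h.1 (by simpa [φ] using h.2)
  have hφreal : ∀ x ∈ β.carrier, φ x = ((x.1 : ℝ) : ℂ) := fun x hx => by
    apply Complex.ext <;> simp [φ, hx.2.2]
  have hmem : ∀ y : ℝ × ℝ, ∀ x ∈ Icc (γ₁.toFun t₁).1 (γ₂.toFun t₂).1, φ y = (x : ℝ) →
      y ∈ β.carrier ∧ y.1 = x := by
    intro y x hx hy
    have h := Complex.ext_iff.1 hy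
    simp only [φ, Complex.ofReal_re, Complex.ofReal_im, sub_eq_zero] at h
    exact ⟨⟨h.1 ▸ hγ₁.left_lt.le.trans hx.1, h.1 ▸ hx.2.trans hγ₂.lt_right.le, h.2⟩, h.1⟩
  suffices hmeet : ∃ u v, (φ ∘ glueAtOne (γ₁.subpath t₁ r₁) (γ₂.subpath t₂ r₂)) u =
      (φ ∘ glueAtOne (δ₁.subpath s₁ q₁) (δ₂.subpath s₂ q₂)) v by
    obtain ⟨u, v, huv⟩ := hmeet
    have := hφinj _ _ huv
    exact ⟨_, glueAtOne_mem (γ₁.subpath_mem t₁ r₁) (γ₂.subpath_mem t₂ r₂) u,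
      this ▸ glueAtOne_mem (δ₁.subpath_mem s₁ q₁) (δ₂.subpath_mem s₂ q₂) v⟩
  refine Complex.exists_eq_of_interlaced
    (hφ.comp (continuous_glueAtOne (continuous_subpath _ _ _) (continuous_subpath _ _ _)
      (by rw [subpath_one, subpath_one, hr])))
    (hφ.comp (continuous_glueAtOne (continuous_subpath _ _ _) (continuous_subpath _ _ _)
      (by rw [subpath_one, subpath_one, hqp₁, hqp₂])))
    (by rw [Function.comp_apply, glueAtOne_zero, subpath_zero, hφreal _ hγ₁.mem])
    (by rw [Function.comp_apply, glueAtOne_one, subpath_zero, hφreal _ hγ₂.mem])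
    (by rw [Function.comp_apply, glueAtOne_zero, subpath_zero, hφreal _ hδ₁.mem])
    (by rw [Function.comp_apply, glueAtOne_one, subpath_zero, hφreal _ hδ₂.mem])
    h₁ h₂ ?_ ?_ ?_ ?_
  -- For every real `u` the glued path stays on `γ₁ ∪ γ₂`, which meets β only at the two crossing
  -- points, both outside the segment between those of `δ₁` and `δ₂`.
  · intro u x hx hux
    have hx' : x ∈ Ioo (γ₁.toFun t₁).1 (γ₂.toFun t₂).1 :=
      ordConnected_Ioo.uIcc_subset h₁ h₂ hx
    obtain ⟨hβ, hx1⟩ := hmem _ x (Ioo_subset_Icc_self hx') hux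
    rcases glueAtOne_mem (γ₁.subpath_mem t₁ r₁) (γ₂.subpath_mem t₂ r₂) u with hh | hh
    · exact hx'.1.ne' (by rw [← hx1, hγ₁.eq_of_mem hh hβ])
    · exact hx'.2.ne (by rw [← hx1, hγ₂.eq_of_mem hh hβ])
  · intro u hu x hx hux
    exact glueAtOne_mem_of_mem_Ioo (s := β.carrierᶜ) (fun v hv => hδ₁.subpath_notMem hq₁ hv)
      (fun v hv => hδ₂.subpath_notMem hq₂ hv) hu (hmem _ x hx hux).1
  · filter_upwards [eventually_glueAtOne_nhdsGT_zero (Q := fun q => β.height < q.2)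
      (g := δ₂.subpath s₂ q₂) hup] with u hu using sub_pos.2 hu
  · filter_upwards [eventually_glueAtOne_nhdsLT_one (Q := fun q => q.2 < β.height)
      (f := δ₁.subpath s₁ q₁) hlow] with u hu using sub_neg.2 hu

end PlaneCurve

/-! ### The coloring bound for curves -/

theorem mainTheorem4 {ι : Type*} (k : ℕ) (hk : 2 ≤ k) (β : HorizontalSegment)
    (C : ι → PlaneCurve)
    (hsimple : PlaneCurve.IsSimpleFamily C)
    (hfree : (PlaneCurve.intersectionGraph C).CliqueFree k)
    (hcross : ∀ i, (C i).CrossesOnce β)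
    (hupper : ∀ i j, i ≠ j → (C i).upperPart β ∩ (C j).upperPart β = ∅)
    (hlower : ∀ i j, i ≠ j → (C i).lowerPart β ∩ (C j).lowerPart β = ∅) :
    (PlaneCurve.intersectionGraph C).chromaticNumber ≤ ((2 ^ (3 * k - 6) : ℕ) : ℕ∞) := by
  obtain ⟨n, rfl⟩ := Nat.exists_eq_add_of_le' hk
  rw [show 3 * (n + 2) - 6 = 3 * n by omega, pow_mul, show 2 ^ 3 = 8 by norm_num,
    SimpleGraph.chromaticNumber_le_iff_colorable]
  choose t ht using hcross
  let x : ι → ℝ := fun i => ((C i).toFun (t i)).1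
  have hpt : ∀ i j, (C i).toFun (t i) = (C j).toFun (t j) → i = j := by
    intro i j hij
    by_contra hne
    exact (eq_empty_iff_forall_notMem.1 (hupper i j hne)) ((C i).toFun (t i))
      ⟨(ht i).mem_upperPart, hij ▸ (ht j).mem_upperPart⟩
  have hx : Function.Injective x := fun i j hij =>
    hpt i j (Prod.ext hij ((ht i).mem.2.2.trans (ht j).mem.2.2.symm))
  -- A common point on β would be the crossing point of both curves, which `hpt` excludes.
  have hcase : ∀ i j, (PlaneCurve.intersectionGraph C).Adj i j → ∃ p ∉ β.carrier,
      p ∈ (C i).upperPart β ∩ (C j).lowerPart β ∨ p ∈ (C j).upperPart β ∩ (C i).lowerPart β := by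
    rintro i j ⟨hne, p, hpi, hpj⟩
    refine ⟨p, fun hp => hne (hpt i j ?_), ?_⟩
    · rw [← (ht i).eq_of_mem hpi hp, ← (ht j).eq_of_mem hpj hp]
    · rcases (ht i).carrier_subset hpi with h1 | h1 <;>
        rcases (ht j).carrier_subset hpj with h2 | h2
      · exact absurd ⟨h1, h2⟩ (eq_empty_iff_forall_notMem.1 (hupper i j hne) p)
      · exact Or.inl ⟨h1, h2⟩
      · exact Or.inr ⟨h2, h1⟩
      · exact absurd ⟨h1, h2⟩ (eq_empty_iff_forall_notMem.1 (hlower i j hne) p)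
  let : LinearOrder ι := LinearOrder.lift' x hx
  have hnest : ∀ i j k l, (PlaneCurve.intersectionGraph C).Adj i j →
      (PlaneCurve.intersectionGraph C).Adj k l → k ∈ Ioo i j → l ∈ Ioo i j →
      (PlaneCurve.intersectionGraph C).Adj i k ∨ (PlaneCurve.intersectionGraph C).Adj i l ∨
      (PlaneCurve.intersectionGraph C).Adj j k ∨ (PlaneCurve.intersectionGraph C).Adj j l := by
    intro i j k l hij hkl hk hl
    have hinter : (((C i).carrier ∪ (C j).carrier) ∩
        ((C k).carrier ∪ (C l).carrier)).Nonempty := by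
      obtain ⟨p, hp, ⟨h1, h2⟩ | ⟨h1, h2⟩⟩ := hcase k l hkl
      · exact PlaneCurve.inter_nonempty_of_interlaced (ht i) (ht j) (ht k) (ht l) hij.2 h1 h2 hp
          hk hl
      · rw [union_comm (C k).carrier]
        exact PlaneCurve.inter_nonempty_of_interlaced (ht i) (ht j) (ht l) (ht k) hij.2 h1 h2 hp
          hl hk
    obtain ⟨p, hp1 | hp1, hp2 | hp2⟩ := hinter
    · exact Or.inl ⟨hk.1.ne, p, hp1, hp2⟩
    · exact Or.inr (Or.inl ⟨hl.1.ne, p, hp1, hp2⟩)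
    · exact Or.inr (Or.inr (Or.inl ⟨hk.2.ne', p, hp1, hp2⟩))
    · exact Or.inr (Or.inr (Or.inr ⟨hl.2.ne', p, hp1, hp2⟩))
  -- The family may be infinite; by de Bruijn–Erdős compactness it suffices to color finite
  -- subgraphs.
  refine SimpleGraph.nonempty_hom_of_forall_finite_subgraph_hom fun G' hG' => ?_
  have : Finite G'.verts := hG'
  have hcol := SimpleGraph.colorable_of_nested_adj n
    ((PlaneCurve.intersectionGraph C).induce G'.verts)
    (fun i j k l hij hkl hk hl => hnest i j k l hij hkl hk hl)
    (hfree.comap ⟨(SimpleGraph.Embedding.induce G'.verts).toCopy⟩)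
  exact hcol.some.comp ⟨id, fun h => G'.adj_sub h⟩
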